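/- There exist universal constants $0<c_1\le 4$ and $0<c_2\le 6$ such that the following holds. Let $D_i,M,L\ge 1$ and $D_o$ be natural numbers and let $\phi:\mathbb R\to\mathbb R$ be $1$-Lipschitz with constant even part, i.e. there is $\alpha\in\mathbb R$ with $\tfrac12(\phi(a)+\phi(-a))=\alpha$ for all $a$. Consider the fully connected network with $L$ hidden layers of width $M$, $$\mathbf z_1=\tfrac1{\sqrt{D_i}}\mathbf W_1\mathbf x+\mathbf b_1,\qquad \mathbf z_\ell=\tfrac1{\sqrt M}\mathbf W_\ell\,\phi(\mathbf z_{\ell-1})+\mathbf b_\ell\ (2\le \ell\le L),\qquad \mathbf f_\theta(\mathbf x)=\tfrac1{\sqrt M}\mathbf W_{L+1}\phi(\mathbf z_L)+\mathbf b_{L+1},$$ where $\mathbf x\in\mathbb R^{D_i}$, $\mathbf f_\theta(\mathbf x)\in\mathbb R^{D_o}$, $\phi$ is applied element-wise and $\theta$ is the vector of all entries of $\mathbf W_1,\mathbf b_1,\dots,\mathbf W_{L+1},\mathbf b_{L+1}$. Put $\widetilde{\mathbf f}_\theta(\mathbf x)=\mathbf f_\theta(\mathbf x)-\tfrac{\alpha}{\sqrt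 M}\mathbf W_{L+1}\mathbf 1-\mathbf b_{L+1}$. Let $P=\mathcal N(\mathbf 0,\mathbf I)$ be the prior on $\theta$, and let $Q=\mathcal N(\boldsymbol\mu,\operatorname{diag}(\boldsymbol\sigma^2))$, with arbitrary means and arbitrary positive variances, be a mean-field Gaussian distribution on $\theta$. Then $\mathrm{KL}(Q,P)<\infty$, the expectations below exist, and for all $\mathbf x\in\mathbb R^{D_i}$ $$\bigl\|\mathbb E_Q[\widetilde{\mathbf f}_\theta(\mathbf x)]\bigr\|_2\le c_1c_2^{L-1}L\,\frac{|\alpha|+1+\|\mathbf x\|_2/\sqrt{D_i}}{\sqrt M}\,\mathrm{KL}(Q,P)\Bigl((2\,\mathrm{KL}(Q,P))^{\frac{L-1}2}\vee 1\Bigr),$$ and, for all $\mathbf x,\mathbf x'\in\mathbb R^{D_i}$ $$\bigl\|\mathbb E_Q[\mathbf f_\theta(\mathbf x)]-\mathbb E_Q[\mathbf f_\theta(\mathbf x')]\bigr\|_2\le c_1c_2^{L-1}L\,\frac{2|\alpha|+2+(\|\mathbf x\|_2+\|\mathbf x'\|_2)/\sqrt{D_i}}{\sqrt M}\,\mathrm{KL}(Q,P)\Bigl((2\,\mathrm{KL}(Q,P))^{\frac{L-1}2}\vee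 1\Bigr),$$ where $a\vee b=\max(a,b)$. -/

import Mathlib

namespace MeanFieldBNN

/-- One index for each scalar parameter of a fully connected network with input dimension `Di`,
`L ≥ 1` hidden layers of width `M`, and output dimension `Do`.
The weights and biases of hidden layers `2, …, L` are indexed by `ℓ : Fin (L - 1)`,
where `ℓ` stands for hidden layer number `ℓ + 2`. -/
inductive ParamIdx (Di M Do L : ℕ) : Type
  | inputWeight (i : Fin M) (j : Fin Di)
  | inputBias (i : Fin M)
  | hiddenWeight (ℓ : Fin (L - 1)) (i j : Fin M)
  | hiddenBias (ℓ : Fin (L - 1)) (i : Fin M)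
  | outputWeight (i : Fin Do) (j : Fin M)
  | outputBias (i : Fin Do)
  deriving DecidableEq, Fintype

/-- The concatenation `θ` of all parameters of the network. -/
abbrev Params (Di M Do L : ℕ) : Type := ParamIdx Di M Do L → ℝ

section Network

variable {Di M Do L : ℕ}

/-- `W₁` -/
def Params.inputWeight (θ : Params Di M Do L) : Matrix (Fin M) (Fin Di) ℝ :=
  Matrix.of fun i j => θ (ParamIdx.inputWeight i j)

/-- `b₁` -/
def Params.inputBias (θ : Params Di M Do L) : Fin M → ℝ :=
  fun i => θ (ParamIdx.inputBias i)

/-- `W_{ℓ+2}` -/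
def Params.hiddenWeight (θ : Params Di M Do L) (ℓ : Fin (L - 1)) : Matrix (Fin M) (Fin M) ℝ :=
  Matrix.of fun i j => θ (ParamIdx.hiddenWeight ℓ i j)

/-- `b_{ℓ+2}` -/
def Params.hiddenBias (θ : Params Di M Do L) (ℓ : Fin (L - 1)) : Fin M → ℝ :=
  fun i => θ (ParamIdx.hiddenBias ℓ i)

/-- `W_{L+1}` -/
def Params.outputWeight (θ : Params Di M Do L) : Matrix (Fin Do) (Fin M) ℝ :=
  Matrix.of fun i j => θ (ParamIdx.outputWeight i j)

/-- `b_{L+1}` -/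
def Params.outputBias (θ : Params Di M Do L) : Fin Do → ℝ :=
  fun i => θ (ParamIdx.outputBias i)

/-- The preactivations: `preact φ θ x ℓ _` is `z_{ℓ+1}(x)`, where
`z₁ = W₁ x / √Di + b₁` and `z_l = W_l φ(z_{l-1}) / √M + b_l` for `2 ≤ l ≤ L`. -/
noncomputable def preact (φ : ℝ → ℝ) (θ : Params Di M Do L) (x : EuclideanSpace ℝ (Fin Di)) :
    (ℓ : ℕ) → ℓ ≤ L - 1 → Fin M → ℝ
  | 0, _ => (1 / √(Di : ℝ)) • θ.inputWeight.mulVec (fun j => x j) + θ.inputBias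
  | ℓ + 1, h =>
      (1 / √(M : ℝ)) • (θ.hiddenWeight ⟨ℓ, h⟩).mulVec
          (fun j => φ (preact φ θ x ℓ (Nat.le_of_succ_le h) j))
        + θ.hiddenBias ⟨ℓ, h⟩

/-- The network output `f_θ(x) = W_{L+1} φ(z_L(x)) / √M + b_{L+1}`. -/
noncomputable def network (φ : ℝ → ℝ) (θ : Params Di M Do L) (x : EuclideanSpace ℝ (Fin Di)) :
    EuclideanSpace ℝ (Fin Do) :=
  WithLp.toLp 2
    ((1 / √(M : ℝ)) • θ.outputWeight.mulVec (fun j => φ (preact φ θ x (L - 1) le_rfl j))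
      + θ.outputBias)

/-- The network output without the final bias and without the contribution of the constant
even part `α` of the final activation: `f_θ(x) - (α / √M) W_{L+1} 1 - b_{L+1}`. -/
noncomputable def networkTilde (φ : ℝ → ℝ) (α : ℝ) (θ : Params Di M Do L)
    (x : EuclideanSpace ℝ (Fin Di)) : EuclideanSpace ℝ (Fin Do) :=
  network φ θ x
    - WithLp.toLp 2 ((α / √(M : ℝ)) • θ.outputWeight.mulVec (fun _ => (1 : ℝ)))
    - WithLp.toLp 2 θ.outputBias

end Network

/-- The even part of a function on the real line. -/
noncomputable def evenPart (φ : ℝ → ℝ) : ℝ → ℝ := fun a => (φ a + φ (-a)) / 2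

/-- The factorized Gaussian distribution with means `m` and variances `v`. -/
noncomputable def diagGaussian {Di M Do L : ℕ} (m : ParamIdx Di M Do L → ℝ)
    (v : ParamIdx Di M Do L → NNReal) : MeasureTheory.Measure (Params Di M Do L) :=
  MeasureTheory.Measure.pi fun i => ProbabilityTheory.gaussianReal (m i) (v i)

/-- The prior: independent standard Gaussians. -/
noncomputable def prior (Di M Do L : ℕ) : MeasureTheory.Measure (Params Di M Do L) :=
  diagGaussian (fun _ => 0) (fun _ => 1)

/-- Membership in the mean-field family: a factorized Gaussian with positive variances. -/
def IsMeanFieldGaussian {Di M Do L : ℕ}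
    (Q : MeasureTheory.Measure (Params Di M Do L)) : Prop :=
  ∃ (m : ParamIdx Di M Do L → ℝ) (v : ParamIdx Di M Do L → NNReal),
    (∀ i, 0 < v i) ∧ Q = diagGaussian m v

/-- The Kullback-Leibler divergence from `Q` to the prior, as a real number. -/
noncomputable def klPrior {Di M Do L : ℕ}
    (Q : MeasureTheory.Measure (Params Di M Do L)) : ℝ :=
  (InformationTheory.klDiv Q (prior Di M Do L)).toReal

end MeanFieldBNN

/-!
At a fixed input, the weights of each layer are independent of the inputs of that layer. Reflecting
these weights at their means preserves the joint law, so the expectation of an odd Lipschitz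
function of a preactivation is controlled by the means of the weights alone. Let `K²` be the sum of
`m² + (σ - 1)²` over all parameters, that is `W₂(Q, P)²`. Talagrand's inequality gives
`K² ≤ 2 KL(Q, P)`; for Gaussians it reduces to `log σ ≤ σ - 1`. One layer multiplies the root mean
square of the activations by at most `1 + K`, up to an additive constant, while the means of the
last hidden layer and of the output layer contribute one factor `K` each. Hence the output has mean
of order `K² (1 + K)^(L - 1) / √M`.
-/

open MeasureTheory ProbabilityTheory InformationTheory
open scoped NNReal ENNReal Matrix

namespace MeanFieldBNN

lemma integral_sq_eq_variance_add_sq {Ω : Type*} [MeasurableSpace Ω] {P : Measure Ω}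
    [IsProbabilityMeasure P] {X : Ω → ℝ} (hX : MemLp X 2 P) :
    ∫ ω, X ω ^ 2 ∂P = Var[X; P] + P[X] ^ 2 := by
  rw [variance_eq_sub hX, sub_add_cancel]
  rfl

section KullbackLeibler

variable {ι : Type*} [Fintype ι] {X : ι → Type*} [∀ i, MeasurableSpace (X i)]

lemma pi_withDensity (ν : ∀ i, Measure (X i)) [∀ i, IsProbabilityMeasure (ν i)]
    {g : ∀ i, X i → ℝ≥0∞} (hg : ∀ i, Measurable (g i))
    [∀ i, SigmaFinite ((ν i).withDensity (g i))] :
    Measure.pi (fun i => (ν i).withDensity (g i))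
      = (Measure.pi ν).withDensity fun x => ∏ i, g i (x i) := by
  refine Measure.pi_eq fun s hs => ?_
  have hgs : ∀ i, Measurable ((s i).indicator (g i)) := fun i => (hg i).indicator (hs i)
  have hindicator : ∀ x, (Set.univ.pi s).indicator (fun x => ∏ i, g i (x i)) x
      = ∏ i, (s i).indicator (g i) (x i) := fun x => by
    by_cases hx : ∀ i, x i ∈ s i
    · rw [Set.indicator_of_mem (by simpa using hx)]
      exact Finset.prod_congr rfl fun i _ => (Set.indicator_of_mem (hx i) _).symm
    · obtain ⟨i, hi⟩ := not_forall.1 hx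
      rw [Set.indicator_of_notMem (by simpa using hx),
        Finset.prod_eq_zero (Finset.mem_univ i) (Set.indicator_of_notMem hi _)]
  calc (Measure.pi ν).withDensity (fun x => ∏ i, g i (x i)) (Set.univ.pi s)
      = ∫⁻ x, ∏ i, (s i).indicator (g i) (x i) ∂Measure.pi ν := by
        rw [withDensity_apply _ (MeasurableSet.univ_pi hs),
          ← lintegral_indicator (MeasurableSet.univ_pi hs), lintegral_congr hindicator]
    _ = ∏ i, ∫⁻ x, (s i).indicator (g i) (x i) ∂Measure.pi ν :=
        lintegral_prod_eq_prod_lintegral_of_indepFun Finset.univ _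
          (iIndepFun_pi fun i => (hgs i).aemeasurable)
          fun i => (hgs i).comp (measurable_pi_apply i)
    _ = ∏ i, (ν i).withDensity (g i) (s i) := by
        refine Finset.prod_congr rfl fun i _ => ?_
        rw [(measurePreserving_eval ν i).lintegral_comp (hgs i), lintegral_indicator (hs i),
          withDensity_apply _ (hs i)]

variable {μ ν : ∀ i, Measure (X i)} [∀ i, IsProbabilityMeasure (μ i)]
  [∀ i, IsProbabilityMeasure (ν i)]

lemma pi_eq_withDensity_prod_rnDeriv (h : ∀ i, μ i ≪ ν i) :
    Measure.pi μ
      = (Measure.pi ν).withDensity fun x => ∏ i, (μ i).rnDeriv (ν i) (x i) := by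
  have hμ : ∀ i, (ν i).withDensity ((μ i).rnDeriv (ν i)) = μ i := fun i =>
    Measure.withDensity_rnDeriv_eq _ _ (h i)
  have : ∀ i, SigmaFinite ((ν i).withDensity ((μ i).rnDeriv (ν i))) := fun i => by
    rw [hμ]; infer_instance
  rw [← pi_withDensity ν fun i => Measure.measurable_rnDeriv _ _]
  exact congrArg Measure.pi (funext fun i => (hμ i).symm)

lemma absolutelyContinuous_pi (h : ∀ i, μ i ≪ ν i) : Measure.pi μ ≪ Measure.pi ν :=
  pi_eq_withDensity_prod_rnDeriv h ▸ withDensity_absolutelyContinuous _ _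

lemma llr_pi (h : ∀ i, μ i ≪ ν i) :
    llr (Measure.pi μ) (Measure.pi ν) =ᵐ[Measure.pi μ] fun x => ∑ i, llr (μ i) (ν i) (x i) := by
  have hdensity : (Measure.pi μ).rnDeriv (Measure.pi ν)
      =ᵐ[Measure.pi ν] fun x => ∏ i, (μ i).rnDeriv (ν i) (x i) := by
    rw [pi_eq_withDensity_prod_rnDeriv h]
    exact Measure.rnDeriv_withDensity _ <| Finset.measurable_fun_prod _ fun i _ =>
      (Measure.measurable_rnDeriv _ _).comp (measurable_pi_apply i)
  have hpos : ∀ᵐ x ∂Measure.pi μ, ∀ i, 0 < ((μ i).rnDeriv (ν i) (x i)).toReal :=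
    ae_all_iff.2 fun i => (measurePreserving_eval μ i).quasiMeasurePreserving.ae <| by
      filter_upwards [Measure.rnDeriv_pos (h i),
        (h i).ae_le (Measure.rnDeriv_lt_top (μ i) (ν i))] with x hx_pos hx_lt_top
      exact ENNReal.toReal_pos hx_pos.ne' hx_lt_top.ne
  filter_upwards [(absolutelyContinuous_pi h).ae_le hdensity, hpos] with x hx hx_pos
  rw [llr, hx, ENNReal.toReal_prod, Real.log_prod fun i _ => (hx_pos i).ne']
  rfl

lemma klDiv_pi_ne_top (h : ∀ i, klDiv (μ i) (ν i) ≠ ∞) :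
    klDiv (Measure.pi μ) (Measure.pi ν) ≠ ∞ := by
  simp only [klDiv_ne_top_iff] at h ⊢
  refine ⟨absolutelyContinuous_pi fun i => (h i).1, ?_⟩
  rw [integrable_congr (llr_pi fun i => (h i).1)]
  exact integrable_finsetSum _ fun i _ => integrable_comp_eval (h i).2

lemma toReal_klDiv_pi (h : ∀ i, klDiv (μ i) (ν i) ≠ ∞) :
    (klDiv (Measure.pi μ) (Measure.pi ν)).toReal = ∑ i, (klDiv (μ i) (ν i)).toReal := by
  simp only [klDiv_ne_top_iff] at h
  rw [toReal_klDiv_of_measure_eq (absolutelyContinuous_pi fun i => (h i).1) (by simp),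
    integral_congr_ae (llr_pi fun i => (h i).1),
    integral_finsetSum _ fun i _ => integrable_comp_eval (h i).2]
  refine Finset.sum_congr rfl fun i _ => ?_
  rw [integral_comp_eval (h i).2.aestronglyMeasurable,
    toReal_klDiv_of_measure_eq (h i).1 (by simp)]

variable {v₁ v₂ : ℝ≥0}

lemma log_gaussianPDFReal (m : ℝ) {v : ℝ≥0} (hv : v ≠ 0) (x : ℝ) :
    Real.log (gaussianPDFReal m v x) = -Real.log (2 * Real.pi * v) / 2 - (x - m) ^ 2 / (2 * v) := by
  have : (0 : ℝ) < v := by positivity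
  rw [gaussianPDFReal, Real.log_mul (by positivity) (Real.exp_pos _).ne', Real.log_exp,
    Real.log_inv, Real.log_sqrt (by positivity)]
  ring

lemma gaussianReal_absolutelyContinuous_gaussianReal (m₁ m₂ : ℝ) (hv₁ : v₁ ≠ 0) (hv₂ : v₂ ≠ 0) :
    gaussianReal m₁ v₁ ≪ gaussianReal m₂ v₂ :=
  (gaussianReal_absolutelyContinuous m₁ hv₁).trans (gaussianReal_absolutelyContinuous' m₂ hv₂)

lemma llr_gaussianReal (m₁ m₂ : ℝ) (hv₁ : v₁ ≠ 0) (hv₂ : v₂ ≠ 0) :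
    llr (gaussianReal m₁ v₁) (gaussianReal m₂ v₂) =ᵐ[gaussianReal m₁ v₁] fun x =>
      Real.log (v₂ / v₁) / 2 + ((x - m₂) ^ 2 / (2 * v₂) - (x - m₁) ^ 2 / (2 * v₁)) := by
  have hv₁' : (v₁ : ℝ) ≠ 0 := NNReal.coe_ne_zero.2 hv₁
  have hv₂' : (v₂ : ℝ) ≠ 0 := NNReal.coe_ne_zero.2 hv₂
  have h₁ := gaussianReal_absolutelyContinuous m₁ hv₁
  have h₂ := gaussianReal_absolutelyContinuous m₂ hv₂
  have h₁₂ := gaussianReal_absolutelyContinuous_gaussianReal m₁ m₂ hv₁ hv₂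
  filter_upwards [h₁₂.ae_le (Measure.rnDeriv_eq_div h₁ h₂), h₁.ae_le (rnDeriv_gaussianReal m₁ v₁),
    h₁.ae_le (rnDeriv_gaussianReal m₂ v₂)] with x hx hx₁ hx₂
  rw [llr, hx, hx₁, hx₂, ENNReal.toReal_div, toReal_gaussianPDF, toReal_gaussianPDF,
    Real.log_div (gaussianPDFReal_pos _ _ _ hv₁).ne' (gaussianPDFReal_pos _ _ _ hv₂).ne',
    log_gaussianPDFReal _ hv₁, log_gaussianPDFReal _ hv₂,
    Real.log_mul Real.two_pi_pos.ne' hv₁', Real.log_mul Real.two_pi_pos.ne' hv₂',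
    Real.log_div hv₂' hv₁']
  ring

lemma integrable_sq_sub_gaussianReal (m c : ℝ) (v : ℝ≥0) :
    Integrable (fun x => (x - c) ^ 2) (gaussianReal m v) :=
  ((memLp_id_gaussianReal' 2 (by simp)).sub (memLp_const c)).integrable_sq

lemma integral_sq_sub_gaussianReal (m c : ℝ) (v : ℝ≥0) :
    ∫ x, (x - c) ^ 2 ∂gaussianReal m v = v + (m - c) ^ 2 := by
  have hid : MemLp (fun x : ℝ => x) 2 (gaussianReal m v) := memLp_id_gaussianReal' 2 (by simp)
  have hsub : MemLp (fun x => x - c) 2 (gaussianReal m v) := hid.sub (memLp_const c)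
  rw [integral_sq_eq_variance_add_sq hsub, variance_sub_const hid.aestronglyMeasurable,
    variance_fun_id_gaussianReal, integral_sub (hid.integrable one_le_two) (integrable_const c),
    integral_id_gaussianReal, integral_const, probReal_univ, one_smul]

lemma klDiv_gaussianReal_ne_top (m₁ m₂ : ℝ) (hv₁ : v₁ ≠ 0) (hv₂ : v₂ ≠ 0) :
    klDiv (gaussianReal m₁ v₁) (gaussianReal m₂ v₂) ≠ ∞ := by
  refine klDiv_ne_top (gaussianReal_absolutelyContinuous_gaussianReal m₁ m₂ hv₁ hv₂) ?_
  rw [integrable_congr (llr_gaussianReal m₁ m₂ hv₁ hv₂)]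
  exact (integrable_const _).add (((integrable_sq_sub_gaussianReal _ _ _).div_const _).sub
    ((integrable_sq_sub_gaussianReal _ _ _).div_const _))

lemma toReal_klDiv_gaussianReal (m₁ m₂ : ℝ) (hv₁ : v₁ ≠ 0) (hv₂ : v₂ ≠ 0) :
    (klDiv (gaussianReal m₁ v₁) (gaussianReal m₂ v₂)).toReal
      = (Real.log (v₂ / v₁) + (v₁ + (m₁ - m₂) ^ 2) / v₂ - 1) / 2 := by
  have hint : ∀ c a, Integrable (fun x : ℝ => (x - c) ^ 2 / a) (gaussianReal m₁ v₁) :=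
    fun c a => (integrable_sq_sub_gaussianReal _ _ _).div_const _
  have hdiff : Integrable (fun x : ℝ => (x - m₂) ^ 2 / (2 * v₂) - (x - m₁) ^ 2 / (2 * v₁))
      (gaussianReal m₁ v₁) := (hint _ _).sub (hint _ _)
  have hv₁' : (v₁ : ℝ) ≠ 0 := NNReal.coe_ne_zero.2 hv₁
  rw [toReal_klDiv_of_measure_eq
      (gaussianReal_absolutelyContinuous_gaussianReal m₁ m₂ hv₁ hv₂) (by simp),
    integral_congr_ae (llr_gaussianReal m₁ m₂ hv₁ hv₂),
    integral_add (integrable_const _) hdiff,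
    integral_sub (hint _ _) (hint _ _), integral_const,
    integral_div, integral_div, integral_sq_sub_gaussianReal, integral_sq_sub_gaussianReal,
    probReal_univ, one_smul, sub_self]
  field_simp
  ring

lemma sq_add_sqrt_sub_one_sq_le_klDiv_gaussianReal (m : ℝ) {v : ℝ≥0} (hv : v ≠ 0) :
    m ^ 2 + (√v - 1) ^ 2 ≤ 2 * (klDiv (gaussianReal m v) (gaussianReal 0 1)).toReal := by
  have hv' : (0 : ℝ) < v := by positivity
  have hlog := Real.log_le_sub_one_of_pos (Real.sqrt_pos.2 hv')
  rw [Real.log_sqrt hv'.le] at hlog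
  rw [toReal_klDiv_gaussianReal m 0 hv one_ne_zero, NNReal.coe_one, one_div, Real.log_inv]
  linarith [Real.sq_sqrt hv'.le, sub_sq √(v : ℝ) 1]

end KullbackLeibler

section RootMeanSquare

variable {Ω κ : Type*} [MeasurableSpace Ω] [Fintype κ] {P : Measure Ω} {X Y : κ → Ω → ℝ}

/-- The root mean square `(𝔼 ‖X‖₂²)^{1/2}` of a random vector `X`, given by its coordinates. -/
noncomputable def rms (P : Measure Ω) (X : κ → Ω → ℝ) : ℝ := √(∑ o, ∫ ω, X o ω ^ 2 ∂P)

lemma rms_nonneg (P : Measure Ω) (X : κ → Ω → ℝ) : 0 ≤ rms P X := Real.sqrt_nonneg _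

lemma rms_sq (P : Measure Ω) (X : κ → Ω → ℝ) : rms P X ^ 2 = ∑ o, ∫ ω, X o ω ^ 2 ∂P :=
  Real.sq_sqrt (Finset.sum_nonneg fun _ _ => integral_nonneg fun _ => sq_nonneg _)

lemma rms_eq_lpNorm (hX : ∀ o, MemLp (X o) 2 P) :
    rms P X = lpNorm (fun ω => WithLp.toLp 2 fun o => X o ω) 2 P := by
  have hmem : MemLp (fun ω => WithLp.toLp 2 fun o => X o ω) 2 P := .of_eval_piLp hX
  rw [lpNorm_eq_integral_norm_rpow_toReal two_ne_zero ENNReal.ofNat_ne_top hmem.1, rms,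
    Real.sqrt_eq_rpow, ← integral_finsetSum _ fun o _ => (hX o).integrable_sq]
  simp [EuclideanSpace.real_norm_sq_eq]

lemma rms_add_le (hX : ∀ o, MemLp (X o) 2 P) (hY : ∀ o, MemLp (Y o) 2 P) :
    rms P (X + Y) ≤ rms P X + rms P Y := by
  rw [rms_eq_lpNorm (X := X + Y) fun o => (hX o).add (hY o), rms_eq_lpNorm hX, rms_eq_lpNorm hY]
  have hmem : MemLp (fun ω => WithLp.toLp 2 fun o => X o ω) 2 P := .of_eval_piLp hX
  exact lpNorm_add_le (g := fun ω => WithLp.toLp 2 fun o => Y o ω) hmem one_le_two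

lemma rms_le_rms_of_abs_le (hY : ∀ o, MemLp (Y o) 2 P) (hXY : ∀ o ω, |X o ω| ≤ |Y o ω|) :
    rms P X ≤ rms P Y := by
  refine Real.sqrt_le_sqrt (Finset.sum_le_sum fun o _ => ?_)
  exact integral_mono_of_nonneg (.of_forall fun _ => sq_nonneg _) (hY o).integrable_sq
    (.of_forall fun ω => sq_le_sq.2 (hXY o ω))

lemma rms_const [IsProbabilityMeasure P] (c : ℝ) :
    rms P (fun (_ : κ) _ => c) = √(Fintype.card κ) * |c| := by
  simp [rms, Real.sqrt_sq_eq_abs]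

lemma rms_const_mul (c : ℝ) : rms P (fun o ω => c * X o ω) = |c| * rms P X := by
  simp only [rms, mul_pow, integral_const_mul]
  rw [← Finset.mul_sum, Real.sqrt_mul (sq_nonneg c), Real.sqrt_sq_eq_abs]

lemma rms_div_const (c : ℝ) : rms P (fun o ω => X o ω / c) = rms P X / |c| := by
  simp only [div_eq_inv_mul, rms_const_mul, abs_inv]

lemma rms_option_le (X : Option κ → Ω → ℝ) :
    rms P X ≤ √(∫ ω, X none ω ^ 2 ∂P) + rms P (fun o => X (some o)) := by
  rw [rms, Fintype.sum_option, rms]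
  have hnone : 0 ≤ ∫ ω, X none ω ^ 2 ∂P := integral_nonneg fun _ => sq_nonneg _
  refine Real.sqrt_le_iff.2 ⟨by positivity, ?_⟩
  rw [add_sq, Real.sq_sqrt hnone, Real.sq_sqrt
    (Finset.sum_nonneg fun _ _ => integral_nonneg fun _ => sq_nonneg _)]
  exact add_le_add_left (le_add_of_nonneg_right (by positivity)) _

lemma lipschitzWith_sub_const {φ : ℝ → ℝ} {C : ℝ≥0} (hφ : LipschitzWith C φ) (c : ℝ) :
    LipschitzWith C fun a => φ a - c :=
  .of_dist_le_mul fun a b => by simpa only [dist_sub_right] using hφ.dist_le_mul a b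

lemma memLp_comp_of_lipschitzWith [IsFiniteMeasure P] {φ : ℝ → ℝ} {C : ℝ≥0}
    (hφ : LipschitzWith C φ) {f : Ω → ℝ} (hf : MemLp f 2 P) :
    MemLp (fun ω => φ (f ω)) 2 P := by
  have hsub : MemLp (fun ω => φ (f ω) - φ 0) 2 P :=
    (lipschitzWith_sub_const hφ (φ 0)).comp_memLp (sub_self _) hf
  simpa only [Pi.add_def, sub_add_cancel] using hsub.add (memLp_const (φ 0))

lemma rms_comp_le_of_lipschitzWith [IsProbabilityMeasure P] {φ : ℝ → ℝ} {C : ℝ≥0}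
    (hφ : LipschitzWith C φ) (hX : ∀ o, MemLp (X o) 2 P) :
    rms P (fun o ω => φ (X o ω)) ≤ √(Fintype.card κ) * |φ 0| + C * rms P X := by
  have hdiff : rms P (fun o ω => φ (X o ω) - φ 0) ≤ rms P (fun o ω => C * X o ω) := by
    refine rms_le_rms_of_abs_le (fun o => (hX o).const_mul C) fun o ω => ?_
    simpa [Real.dist_eq, abs_mul] using hφ.dist_le_mul (X o ω) 0
  calc rms P (fun o ω => φ (X o ω))
      = rms P ((fun _ _ => φ 0) + fun o ω => φ (X o ω) - φ 0) := by
        congr 1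
        funext o ω
        exact (add_sub_cancel _ _).symm
    _ ≤ rms P (fun (_ : κ) _ => φ 0) + rms P (fun o ω => φ (X o ω) - φ 0) :=
        rms_add_le (fun _ => memLp_const _) fun o =>
          (memLp_comp_of_lipschitzWith hφ (hX o)).sub (memLp_const _)
    _ ≤ rms P (fun (_ : κ) _ => φ 0) + rms P (fun o ω => C * X o ω) := by gcongr
    _ = √(Fintype.card κ) * |φ 0| + C * rms P X := by
        rw [rms_const, rms_const_mul, NNReal.abs_eq]

lemma sq_integral_le_integral_sq [IsProbabilityMeasure P] {f : Ω → ℝ} (hf : MemLp f 2 P) :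
    (∫ ω, f ω ∂P) ^ 2 ≤ ∫ ω, f ω ^ 2 ∂P :=
  integral_sq_eq_variance_add_sq hf ▸ le_add_of_nonneg_left (variance_nonneg _ _)

lemma integral_sum_mul_sq_le (a : κ → ℝ) (hX : ∀ o, MemLp (X o) 2 P) :
    ∫ ω, (∑ o, a o * X o ω) ^ 2 ∂P ≤ (∑ o, a o ^ 2) * rms P X ^ 2 := by
  rw [rms_sq, ← integral_finsetSum _ fun o _ => (hX o).integrable_sq, ← integral_const_mul]
  refine integral_mono ?_ ?_ fun ω => Finset.sum_mul_sq_le_sq_mul_sq _ _ _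
  · exact (memLp_finsetSum _ fun o _ => (hX o).const_mul (a o)).integrable_sq
  · exact (integrable_finsetSum _ fun o _ => (hX o).integrable_sq).const_mul _

end RootMeanSquare

section OddLipschitz

variable {Ω : Type*} [MeasurableSpace Ω] {P : Measure Ω} {ψ : ℝ → ℝ} {C : ℝ≥0}

lemma sq_integral_comp_le_of_odd [IsProbabilityMeasure P] (hψ : LipschitzWith C ψ)
    (hodd : ψ.Odd) {X Y : Ω → ℝ} (hX : MemLp X 2 P) (hXY : IdentDistrib X Y P P) :
    (∫ ω, ψ (X ω) ∂P) ^ 2 ≤ C ^ 2 * ∫ ω, ((X ω + Y ω) / 2) ^ 2 ∂P := by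
  have hψ0 : ψ 0 = 0 := hodd.map_zero
  have hY : MemLp Y 2 P := hXY.memLp_iff.1 hX
  have hψX : MemLp (fun ω => ψ (X ω)) 2 P := hψ.comp_memLp hψ0 hX
  have hψY : MemLp (fun ω => ψ (Y ω)) 2 P := hψ.comp_memLp hψ0 hY
  have hmean : ∫ ω, ψ (X ω) ∂P = ∫ ω, (ψ (X ω) + ψ (Y ω)) / 2 ∂P := by
    have heq : ∫ ω, ψ (X ω) ∂P = ∫ ω, ψ (Y ω) ∂P :=
      (hXY.comp hψ.continuous.measurable).integral_eq
    rw [integral_div, integral_add (hψX.integrable one_le_two) (hψY.integrable one_le_two), ← heq]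
    ring
  have hbound : ∀ ω, ((ψ (X ω) + ψ (Y ω)) / 2) ^ 2 ≤ C ^ 2 * ((X ω + Y ω) / 2) ^ 2 := fun ω => by
    have h := hψ.dist_le_mul (X ω) (-Y ω)
    rw [hodd, Real.dist_eq, Real.dist_eq, sub_neg_eq_add, sub_neg_eq_add] at h
    have h₂ := pow_le_pow_left₀ (abs_nonneg _) h 2
    rw [mul_pow, sq_abs, sq_abs] at h₂
    linarith
  have hmem : ∀ {U V : Ω → ℝ}, MemLp U 2 P → MemLp V 2 P →
      MemLp (fun ω => (U ω + V ω) / 2) 2 P := fun hU hV => by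
    simpa only [div_eq_inv_mul, Pi.add_apply] using (hU.add hV).const_mul 2⁻¹
  rw [hmean, ← integral_const_mul]
  exact (sq_integral_le_integral_sq (hmem hψX hψY)).trans
    (integral_mono (hmem hψX hψY).integrable_sq ((hmem hX hY).integrable_sq.const_mul _) hbound)

end OddLipschitz

section RandomNeuron

lemma dotProduct_fun_apply {Ω κ : Type*} [Fintype κ] (w H : κ → Ω → ℝ) (ω : Ω) :
    (w ⬝ᵥ H) ω = ∑ o, w o ω * H o ω := by
  simp only [dotProduct, Finset.sum_apply, Pi.mul_apply]

variable {Ω κ : Type*} [MeasurableSpace Ω] {P : Measure Ω}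

/-- The weights `w` and inputs `H` of a neuron are square integrable, the weights are independent of
each other, and jointly independent of the inputs. The inputs may depend on each other. -/
structure IsRandomNeuron (P : Measure Ω) (w H : κ → Ω → ℝ) : Prop where
  memLp_weight : ∀ o, MemLp (w o) 2 P
  memLp_input : ∀ o, MemLp (H o) 2 P
  iIndepFun_weight : iIndepFun w P
  indepFun_weight_input : IndepFun (fun ω o => w o ω) (fun ω o => H o ω) P

/-- For a Gaussian random variable, this is the squared 2-Wasserstein distance between its law and
the standard Gaussian. -/
noncomputable def standardizationGap (P : Measure Ω) (X : Ω → ℝ) : ℝ :=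
  P[X] ^ 2 + (√Var[X; P] - 1) ^ 2

lemma standardizationGap_nonneg (P : Measure Ω) (X : Ω → ℝ) : 0 ≤ standardizationGap P X := by
  unfold standardizationGap; positivity

lemma sq_integral_le_standardizationGap (P : Measure Ω) (X : Ω → ℝ) :
    P[X] ^ 2 ≤ standardizationGap P X :=
  le_add_of_nonneg_right (sq_nonneg _)

/-- The law of `X` is invariant under reflection at its mean. -/
def IsMeanSymmetric (P : Measure Ω) (X : Ω → ℝ) : Prop :=
  IdentDistrib X (fun ω => 2 * P[X] - X ω) P P

namespace IsRandomNeuron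

variable {w H : κ → Ω → ℝ} {ψ : ℝ → ℝ} {C : ℝ≥0}

lemma indepFun_comp (h : IsRandomNeuron P w H) {f g : (κ → ℝ) → ℝ} (hf : Measurable f)
    (hg : Measurable g) :
    IndepFun (fun ω => f fun o => w o ω) (fun ω => g fun o => H o ω) P :=
  h.indepFun_weight_input.comp hf hg

lemma memLp_mul (h : IsRandomNeuron P w H) (o : κ) : MemLp (w o * H o) 2 P := by
  refine (memLp_two_iff_integrable_sq
    ((h.memLp_weight o).1.mul (h.memLp_input o).1)).2 ?_
  have hind := h.indepFun_comp (f := (· o ^ 2)) (g := (· o ^ 2))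
    (by fun_prop) (by fun_prop)
  simp only [Pi.mul_apply, mul_pow]
  exact hind.integrable_mul (h.memLp_weight o).integrable_sq (h.memLp_input o).integrable_sq

lemma integral_mul (h : IsRandomNeuron P w H) (o : κ) :
    ∫ ω, w o ω * H o ω ∂P = P[w o] * P[H o] :=
  (h.indepFun_comp (f := fun y => y o) (g := fun y => y o) (by fun_prop)
    (by fun_prop)).integral_fun_mul_eq_mul_integral (h.memLp_weight o).1 (h.memLp_input o).1

lemma integral_mul_weight [IsProbabilityMeasure P] [DecidableEq κ] (h : IsRandomNeuron P w H)
    (o p : κ) :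
    ∫ ω, w o ω * w p ω ∂P = P[w o] * P[w p] + if o = p then Var[w o; P] else 0 := by
  split_ifs with hop
  · subst hop
    simp only [← sq]
    rw [integral_sq_eq_variance_add_sq (h.memLp_weight o), add_comm]
  · rw [add_zero]
    exact (h.iIndepFun_weight.indepFun hop).integral_fun_mul_eq_mul_integral
      (h.memLp_weight o).1 (h.memLp_weight p).1

lemma integral_mul_mul_mul (h : IsRandomNeuron P w H) (o p : κ) :
    ∫ ω, w o ω * H o ω * (w p ω * H p ω) ∂P
      = (∫ ω, w o ω * w p ω ∂P) * ∫ ω, H o ω * H p ω ∂P := by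
  have hind := h.indepFun_comp (f := fun y => y o * y p) (g := fun y => y o * y p)
    (by fun_prop) (by fun_prop)
  rw [← hind.integral_fun_mul_eq_mul_integral ((h.memLp_weight o).1.mul (h.memLp_weight p).1)
    ((h.memLp_input o).1.mul (h.memLp_input p).1)]
  simp only [mul_mul_mul_comm]

variable [Fintype κ]

lemma memLp_dotProduct (h : IsRandomNeuron P w H) : MemLp (w ⬝ᵥ H) 2 P :=
  memLp_finsetSum' _ fun o _ => h.memLp_mul o

lemma integral_dotProduct [IsProbabilityMeasure P] (h : IsRandomNeuron P w H) :
    ∫ ω, (w ⬝ᵥ H) ω ∂P = ∑ o, P[w o] * P[H o] := by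
  have hint : ∀ o, Integrable (fun ω => w o ω * H o ω) P := fun o =>
    (h.memLp_mul o).integrable one_le_two
  simp only [dotProduct_fun_apply]
  rw [integral_finsetSum _ fun o _ => hint o]
  exact Finset.sum_congr rfl fun o _ => h.integral_mul o

lemma integral_dotProduct_sq [IsProbabilityMeasure P] (h : IsRandomNeuron P w H) :
    ∫ ω, (w ⬝ᵥ H) ω ^ 2 ∂P
      = ∫ ω, (∑ o, P[w o] * H o ω) ^ 2 ∂P + ∑ o, Var[w o; P] * ∫ ω, H o ω ^ 2 ∂P := by
  classical
  have hint : ∀ o p, Integrable (fun ω => w o ω * H o ω * (w p ω * H p ω)) P := fun o p =>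
    (h.memLp_mul o).integrable_mul (h.memLp_mul p)
  have hint_mean : ∀ o p, Integrable (fun ω => P[w o] * H o ω * (P[w p] * H p ω)) P := fun o p =>
    ((h.memLp_input o).const_mul _).integrable_mul ((h.memLp_input p).const_mul _)
  have hmean : ∀ o p, ∫ ω, P[w o] * H o ω * (P[w p] * H p ω) ∂P
      = P[w o] * P[w p] * ∫ ω, H o ω * H p ω ∂P := fun o p => by
    rw [← integral_const_mul]
    simp only [mul_mul_mul_comm]
  simp only [dotProduct_fun_apply, sq, Finset.sum_mul_sum]
  rw [integral_finsetSum _ fun o _ => integrable_finsetSum _ fun p _ => hint o p,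
    integral_finsetSum _ fun o _ => integrable_finsetSum _ fun p _ => hint_mean o p,
    ← Finset.sum_add_distrib]
  refine Finset.sum_congr rfl fun o _ => ?_
  rw [integral_finsetSum _ fun p _ => hint o p, integral_finsetSum _ fun p _ => hint_mean o p]
  simp only [h.integral_mul_mul_mul, h.integral_mul_weight, add_mul, Finset.sum_add_distrib,
    ite_mul, zero_mul, Finset.sum_ite_eq, Finset.mem_univ, if_true, hmean]

lemma identDistrib_reflect [IsProbabilityMeasure P] (h : IsRandomNeuron P w H)
    (hsymm : ∀ o, IsMeanSymmetric P (w o)) :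
    IdentDistrib (w ⬝ᵥ H) ((fun o ω => 2 * P[w o] - w o ω) ⬝ᵥ H) P P := by
  have hreflect : Measurable fun (y : κ → ℝ) o => 2 * P[w o] - y o := by fun_prop
  have hweight : IdentDistrib (fun ω o => w o ω) (fun ω o => 2 * P[w o] - w o ω) P P :=
    .pi hsymm h.iIndepFun_weight <|
      h.iIndepFun_weight.comp (fun o t => 2 * (∫ ω, w o ω ∂P) - t) fun o => by fun_prop
  have hinput : AEMeasurable (fun ω o => H o ω) P :=
    aemeasurable_pi_lambda _ fun o => (h.memLp_input o).1.aemeasurable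
  have hjoint := hweight.prodMk (.refl hinput) h.indepFun_weight_input
    (h.indepFun_weight_input.comp hreflect measurable_id)
  have hdot : Measurable fun y : (κ → ℝ) × (κ → ℝ) => ∑ o, y.1 o * y.2 o := by fun_prop
  convert hjoint.comp hdot using 1 <;>
  · funext ω
    exact dotProduct_fun_apply _ _ ω

lemma sq_integral_comp_dotProduct_le_of_odd [IsProbabilityMeasure P] (h : IsRandomNeuron P w H)
    (hsymm : ∀ o, IsMeanSymmetric P (w o)) (hψ : LipschitzWith C ψ) (hodd : ψ.Odd) :
    (∫ ω, ψ ((w ⬝ᵥ H) ω) ∂P) ^ 2 ≤ C ^ 2 * ((∑ o, P[w o] ^ 2) * rms P H ^ 2) := by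
  have hmean : ∀ ω, ((w ⬝ᵥ H) ω + ((fun o ω => 2 * P[w o] - w o ω) ⬝ᵥ H) ω) / 2
      = ∑ o, P[w o] * H o ω := fun ω => by
    rw [dotProduct_fun_apply, dotProduct_fun_apply, ← Finset.sum_add_distrib, Finset.sum_div]
    exact Finset.sum_congr rfl fun o _ => by ring
  have hbound := sq_integral_comp_le_of_odd hψ hodd h.memLp_dotProduct
    (h.identDistrib_reflect hsymm)
  simp only [hmean] at hbound
  exact hbound.trans
    (mul_le_mul_of_nonneg_left (integral_sum_mul_sq_le _ h.memLp_input) (sq_nonneg _))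

end IsRandomNeuron

end RandomNeuron

section RandomLayer

variable {Ω κ ρ : Type*} [MeasurableSpace Ω] [Fintype κ] [Fintype ρ] {P : Measure Ω}
  {W : Matrix ρ κ (Ω → ℝ)} {H : κ → Ω → ℝ} {ψ : ℝ → ℝ} {C : ℝ≥0} {K : ℝ}

lemma add_sum_sq_le_of_add_sum_sub_one_sq_le {s : ρ → ℝ} {N : ℝ} (hN : 0 ≤ N) (hK : 0 ≤ K)
    (h : N + ∑ i, (s i - 1) ^ 2 ≤ K ^ 2) :
    N + ∑ i, s i ^ 2 ≤ (√(Fintype.card ρ) + K) ^ 2 := by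
  have hcard : (0 : ℝ) ≤ Fintype.card ρ := Nat.cast_nonneg _
  have hsum : ∑ i, (s i - 1) ≤ √(Fintype.card ρ) * K := by
    refine le_of_sq_le_sq ?_ (by positivity)
    rw [mul_pow, Real.sq_sqrt hcard, ← Finset.card_univ]
    refine sq_sum_le_card_mul_sum_sq.trans (mul_le_mul_of_nonneg_left ?_ (by simp))
    linarith
  have hexpand : ∑ i, s i ^ 2
      = ∑ i, (s i - 1) ^ 2 + 2 * ∑ i, (s i - 1) + Fintype.card ρ := by
    rw [← Finset.card_univ, Finset.cast_card, Finset.mul_sum, ← Finset.sum_add_distrib,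
      ← Finset.sum_add_distrib]
    exact Finset.sum_congr rfl fun i _ => by ring
  rw [hexpand, add_sq, Real.sq_sqrt hcard]
  linarith

lemma sum_sum_sq_integral_add_sum_variance_le (hK : 0 ≤ K)
    (hgap : ∑ i, ∑ o, standardizationGap P (W i o) ≤ K ^ 2) (o : κ) :
    ∑ i, ∑ p, P[W i p] ^ 2 + ∑ i, Var[W i o; P] ≤ (√(Fintype.card ρ) + K) ^ 2 := by
  have hrow : ∑ i, (√Var[W i o; P] - 1) ^ 2 ≤ ∑ i, ∑ p, (√Var[W i p; P] - 1) ^ 2 :=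
    Finset.sum_le_sum fun i _ => Finset.single_le_sum
      (f := fun p => (√Var[W i p; P] - 1) ^ 2) (fun _ _ => sq_nonneg _) (Finset.mem_univ o)
  simp only [standardizationGap, Finset.sum_add_distrib] at hgap
  simpa only [Real.sq_sqrt (variance_nonneg _ _)] using
    add_sum_sq_le_of_add_sum_sub_one_sq_le (by positivity) hK
      ((add_le_add_right hrow _).trans hgap)

lemma sum_sum_sq_integral_le (hgap : ∑ i, ∑ o, standardizationGap P (W i o) ≤ K ^ 2) :
    ∑ i, ∑ o, P[W i o] ^ 2 ≤ K ^ 2 :=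
  (Finset.sum_le_sum fun _ _ => Finset.sum_le_sum fun _ _ =>
    sq_integral_le_standardizationGap P _).trans hgap

variable [IsProbabilityMeasure P]

lemma rms_mulVec_le (hW : ∀ i, IsRandomNeuron P (W i) H) (hK : 0 ≤ K)
    (hgap : ∑ i, ∑ o, standardizationGap P (W i o) ≤ K ^ 2) :
    rms P (W *ᵥ H) ≤ (√(Fintype.card ρ) + K) * rms P H := by
  refine le_of_sq_le_sq ?_ (mul_nonneg (by positivity) (rms_nonneg _ _))
  rw [mul_pow, rms_sq]
  calc ∑ i, ∫ ω, (W *ᵥ H) i ω ^ 2 ∂P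
      = ∑ i, (∫ ω, (∑ o, P[W i o] * H o ω) ^ 2 ∂P
          + ∑ o, Var[W i o; P] * ∫ ω, H o ω ^ 2 ∂P) :=
        Finset.sum_congr rfl fun i _ => (hW i).integral_dotProduct_sq
    _ ≤ ∑ i, ((∑ o, P[W i o] ^ 2) * rms P H ^ 2 + ∑ o, Var[W i o; P] * ∫ ω, H o ω ^ 2 ∂P) := by
        gcongr with i
        exact integral_sum_mul_sq_le _ (hW i).memLp_input
    _ = ∑ o, (∑ i, ∑ p, P[W i p] ^ 2 + ∑ i, Var[W i o; P]) * ∫ ω, H o ω ^ 2 ∂P := by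
        rw [Finset.sum_add_distrib, Finset.sum_comm, rms_sq, ← Finset.sum_mul, Finset.mul_sum,
          ← Finset.sum_add_distrib]
        exact Finset.sum_congr rfl fun o _ => by rw [add_mul, ← Finset.sum_mul]
    _ ≤ ∑ o, (√(Fintype.card ρ) + K) ^ 2 * ∫ ω, H o ω ^ 2 ∂P := by
        gcongr with o
        exact sum_sum_sq_integral_add_sum_variance_le hK hgap o
    _ = (√(Fintype.card ρ) + K) ^ 2 * rms P H ^ 2 := by rw [rms_sq, Finset.mul_sum]

lemma sum_sq_integral_comp_mulVec_le_of_odd (hW : ∀ i, IsRandomNeuron P (W i) H)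
    (hgap : ∑ i, ∑ o, standardizationGap P (W i o) ≤ K ^ 2)
    (hsymm : ∀ i o, IsMeanSymmetric P (W i o)) (hψ : LipschitzWith C ψ) (hodd : ψ.Odd) :
    ∑ i, (∫ ω, ψ ((W *ᵥ H) i ω) ∂P) ^ 2 ≤ (C * (K * rms P H)) ^ 2 :=
  calc ∑ i, (∫ ω, ψ ((W *ᵥ H) i ω) ∂P) ^ 2
      ≤ ∑ i, C ^ 2 * ((∑ o, P[W i o] ^ 2) * rms P H ^ 2) :=
        Finset.sum_le_sum fun i _ =>
          (hW i).sq_integral_comp_dotProduct_le_of_odd (hsymm i) hψ hodd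
    _ = C ^ 2 * ((∑ i, ∑ o, P[W i o] ^ 2) * rms P H ^ 2) := by
        rw [← Finset.mul_sum, ← Finset.sum_mul]
    _ ≤ C ^ 2 * (K ^ 2 * rms P H ^ 2) := by
        gcongr
        exact sum_sum_sq_integral_le hgap
    _ = (C * (K * rms P H)) ^ 2 := by ring

lemma sum_sq_integral_mulVec_le (hW : ∀ i, IsRandomNeuron P (W i) H)
    (hgap : ∑ i, ∑ o, standardizationGap P (W i o) ≤ K ^ 2) :
    ∑ i, (∫ ω, (W *ᵥ H) i ω ∂P) ^ 2 ≤ K ^ 2 * ∑ o, P[H o] ^ 2 :=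
  calc ∑ i, (∫ ω, (W *ᵥ H) i ω ∂P) ^ 2
      ≤ ∑ i, (∑ o, P[W i o] ^ 2) * ∑ o, P[H o] ^ 2 :=
        Finset.sum_le_sum fun i _ => by
          rw [show ∫ ω, (W *ᵥ H) i ω ∂P = _ from (hW i).integral_dotProduct]
          exact Finset.sum_mul_sq_le_sq_mul_sq _ _ _
    _ = (∑ i, ∑ o, P[W i o] ^ 2) * ∑ o, P[H o] ^ 2 := (Finset.sum_mul _ _ _).symm
    _ ≤ K ^ 2 * ∑ o, P[H o] ^ 2 := by
        gcongr
        exact sum_sum_sq_integral_le hgap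

end RandomLayer

section IndependentParameters

variable {ι κ ρ : Type*} {P : Measure (ι → ℝ)}

/-- The coordinates of a random vector with law `P` are independent, square integrable and
symmetric about their means. -/
structure IsIndepSymmetric (P : Measure (ι → ℝ)) : Prop where
  iIndepFun_eval : iIndepFun (fun k (θ : ι → ℝ) => θ k) P
  memLp_eval : ∀ k, MemLp (fun θ : ι → ℝ => θ k) 2 P
  isMeanSymmetric_eval : ∀ k, IsMeanSymmetric P fun θ : ι → ℝ => θ k

/-- The random matrix whose `(i, o)` entry is the coordinate `e i o` of the parameter vector. -/
def coordMatrix (e : ρ → κ → ι) : Matrix ρ κ ((ι → ℝ) → ℝ) := Matrix.of fun i o θ => θ (e i o)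

lemma sum_sum_standardizationGap_coordMatrix_le [Fintype ι] [Fintype κ] [Fintype ρ]
    {e : ρ → κ → ι} (he : Function.Injective2 e) :
    ∑ i, ∑ o, standardizationGap P (coordMatrix e i o)
      ≤ ∑ k, standardizationGap P fun θ => θ k := by
  rw [← Fintype.sum_prod_type']
  exact (Finset.sum_map Finset.univ ⟨_, he.uncurry⟩
    fun k => standardizationGap P fun θ => θ k).symm.trans_le
      (Finset.sum_le_univ_sum_of_nonneg fun k => standardizationGap_nonneg _ _)

lemma indepFun_of_dependsOn [Finite ι] [Finite κ] {β : Type*} [MeasurableSpace β]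
    (hP : iIndepFun (fun k (θ : ι → ℝ) => θ k) P) (e : κ → ι) {G : (ι → ℝ) → β}
    (hG : Measurable G) (hdep : DependsOn G (Set.range e)ᶜ) :
    IndepFun (fun θ o => θ (e o)) G P := by
  classical
  have := Fintype.ofFinite ι
  have := Fintype.ofFinite κ
  set S : Finset ι := Finset.univ.image e with hS
  have hmem : ∀ o, e o ∈ S := fun o => Finset.mem_image_of_mem e (Finset.mem_univ o)
  have hind := hP.indepFun_finset₀ S Sᶜ disjoint_compl_right
    fun i => (measurable_pi_apply i).aemeasurable
  have hrestrict : Measurable fun (y : S → ℝ) (o : κ) => y ⟨e o, hmem o⟩ := by fun_prop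
  have hextend : Measurable fun (y : (Sᶜ : Finset ι) → ℝ) (i : ι) =>
      if hi : i ∈ Sᶜ then y ⟨i, hi⟩ else 0 := by
    refine measurable_pi_lambda _ fun i => ?_
    by_cases hi : i ∈ Sᶜ <;> simp only [hi, dite_true, dite_false] <;> fun_prop
  refine (hind.comp hrestrict (hG.comp hextend)).congr .rfl
    (.of_forall fun θ => hdep fun i hi => ?_)
  have hi' : i ∈ Sᶜ := by simpa [hS] using hi
  simp only [hi', dite_true]

lemma IsIndepSymmetric.isRandomNeuron_coordMatrix [Finite ι] [Finite κ] (hP : IsIndepSymmetric P)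
    {e : ρ → κ → ι} (he : Function.Injective2 e) {H : κ → (ι → ℝ) → ℝ}
    (hmeas : ∀ o, Measurable (H o)) (hH : ∀ o, MemLp (H o) 2 P)
    (hdep : ∀ i o, DependsOn (H o) (Set.range (e i))ᶜ) (i : ρ) :
    IsRandomNeuron P (coordMatrix e i) H where
  memLp_weight o := hP.memLp_eval (e i o)
  memLp_input := hH
  iIndepFun_weight := hP.iIndepFun_eval.precomp (g := e i) (he.right i)
  indepFun_weight_input := indepFun_of_dependsOn hP.iIndepFun_eval (e i)
    (measurable_pi_lambda _ hmeas) fun _ _ h => funext fun o => hdep i o h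

variable [Fintype ι] {m : ι → ℝ} {v : ι → ℝ≥0}

lemma memLp_eval_pi_gaussianReal (k : ι) :
    MemLp (fun θ : ι → ℝ => θ k) 2 (Measure.pi fun k => gaussianReal (m k) (v k)) :=
  (memLp_id_gaussianReal' 2 (by simp)).comp_measurePreserving
    (measurePreserving_eval (fun k => gaussianReal (m k) (v k)) k)

lemma integral_eval_pi_gaussianReal (k : ι) :
    ∫ θ, θ k ∂Measure.pi (fun k => gaussianReal (m k) (v k)) = m k := by
  rw [integral_eval, integral_id_gaussianReal]

lemma isIndepSymmetric_pi_gaussianReal (m : ι → ℝ) (v : ι → ℝ≥0) :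
    IsIndepSymmetric (Measure.pi fun k => gaussianReal (m k) (v k)) where
  iIndepFun_eval := iIndepFun_pi (X := fun _ x => x) fun _ => aemeasurable_id
  memLp_eval := memLp_eval_pi_gaussianReal
  isMeanSymmetric_eval k := by
    have heval := measurePreserving_eval (fun k => gaussianReal (m k) (v k)) k
    refine ⟨(measurable_pi_apply k).aemeasurable,
      (measurable_const.sub (measurable_pi_apply k)).aemeasurable, ?_⟩
    rw [integral_eval_pi_gaussianReal]
    have hreflect := Measure.map_map (μ := Measure.pi fun k => gaussianReal (m k) (v k))
      (g := fun t => 2 * m k - t) (f := Function.eval k) (by fun_prop) (by fun_prop)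
    rw [heval.map_eq, gaussianReal_map_const_sub] at hreflect
    refine (heval.map_eq.trans ?_).trans hreflect
    congr 1
    ring

lemma standardizationGap_eval_pi_gaussianReal (k : ι) :
    standardizationGap (Measure.pi fun k => gaussianReal (m k) (v k)) (fun θ => θ k)
      = m k ^ 2 + (√(v k) - 1) ^ 2 := by
  have hvar := (measurePreserving_eval (fun k => gaussianReal (m k) (v k)) k).variance_fun_comp
    (f := fun t => t) (by fun_prop)
  rw [standardizationGap, integral_eval_pi_gaussianReal, hvar, variance_fun_id_gaussianReal]

end IndependentParameters

section LayerStructure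

variable {Di M Do L : ℕ}

/-- The number of inputs of hidden layer number `ℓ + 1`, not counting the bias. -/
def fanIn (Di M : ℕ) : ℕ → ℕ
  | 0 => Di
  | _ + 1 => M

/-- The parameters feeding unit `i` of hidden layer number `ℓ + 1`; `none` stands for the bias. -/
def layerIdx : (ℓ : ℕ) → ℓ ≤ L - 1 → Fin M → Option (Fin (fanIn Di M ℓ)) → ParamIdx Di M Do L
  | 0, _, i, none => .inputBias i
  | 0, _, i, some j => .inputWeight i j
  | ℓ + 1, h, i, none => .hiddenBias ⟨ℓ, h⟩ i
  | ℓ + 1, h, i, some j => .hiddenWeight ⟨ℓ, h⟩ i j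

/-- The scaled inputs of hidden layer number `ℓ + 1`, extended by the constant `1` that multiplies
the bias, as functions of the parameters. -/
noncomputable def layerInput (φ : ℝ → ℝ) (x : EuclideanSpace ℝ (Fin Di)) :
    (ℓ : ℕ) → ℓ ≤ L - 1 → Option (Fin (fanIn Di M ℓ)) → Params Di M Do L → ℝ
  | _, _, none, _ => 1
  | 0, _, some j, _ => x j / √Di
  | ℓ + 1, h, some j, θ => φ (preact φ θ x ℓ (Nat.le_of_succ_le h) j) / √M

/-- The number of layers below the one that a parameter belongs to. -/
def level : ParamIdx Di M Do L → ℕ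
  | .inputWeight _ _ => 0
  | .inputBias _ => 0
  | .hiddenWeight ℓ _ _ => ℓ + 1
  | .hiddenBias ℓ _ => ℓ + 1
  | .outputWeight _ _ => L - 1 + 1
  | .outputBias _ => L - 1 + 1

lemma level_layerIdx (ℓ : ℕ) (h : ℓ ≤ L - 1) (i : Fin M) (o : Option (Fin (fanIn Di M ℓ))) :
    level (layerIdx ℓ h i o : ParamIdx Di M Do L) = ℓ := by
  cases ℓ <;> cases o <;> rfl

lemma injective2_layerIdx (ℓ : ℕ) (h : ℓ ≤ L - 1) :
    Function.Injective2 (layerIdx ℓ h : Fin M → _ → ParamIdx Di M Do L) := by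
  cases ℓ <;> rintro i i' (_ | j) (_ | j') hij <;> cases hij <;> exact ⟨rfl, rfl⟩

lemma injective2_outputWeight :
    Function.Injective2 (.outputWeight : Fin Do → Fin M → ParamIdx Di M Do L) :=
  fun _ _ _ _ => ParamIdx.outputWeight.inj

variable (φ : ℝ → ℝ) (x : EuclideanSpace ℝ (Fin Di)) (ℓ : ℕ) (h : ℓ ≤ L - 1)

lemma preact_eq_mulVec (i : Fin M) (θ : Params Di M Do L) :
    preact φ θ x ℓ h i = (coordMatrix (layerIdx ℓ h) *ᵥ layerInput φ x ℓ h) i θ := by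
  rw [Matrix.mulVec, dotProduct_fun_apply, Fintype.sum_option, add_comm]
  cases ℓ <;>
  · simp only [preact, Pi.add_apply, Pi.smul_apply, smul_eq_mul, Matrix.mulVec, dotProduct,
      Finset.mul_sum, layerInput, mul_one]
    congr 1
    refine Finset.sum_congr rfl fun j _ => ?_
    rw [one_div_mul_eq_div, mul_div_assoc]
    rfl

variable {φ x ℓ h}

lemma preact_congr {θ θ' : Params Di M Do L}
    (hθ : ∀ i o, θ (layerIdx ℓ h i o) = θ' (layerIdx ℓ h i o))
    (hinput : ∀ o, layerInput φ x ℓ h o θ = layerInput φ x ℓ h o θ') :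
    preact φ θ x ℓ h = preact φ θ' x ℓ h := by
  funext i
  simp only [preact_eq_mulVec, Matrix.mulVec, dotProduct_fun_apply, coordMatrix, Matrix.of_apply,
    hθ, hinput]

lemma dependsOn_layerInput (o : Option (Fin (fanIn Di M ℓ))) :
    DependsOn (layerInput φ x ℓ h o : Params Di M Do L → ℝ) {k | level k < ℓ} := by
  induction ℓ with
  | zero => cases o <;> exact fun _ _ _ => rfl
  | succ ℓ ih =>
    intro θ θ' hθ
    cases o with
    | none => rfl
    | some j =>
      have hz : preact φ θ x ℓ (Nat.le_of_succ_le h) = preact φ θ' x ℓ (Nat.le_of_succ_le h) :=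
        preact_congr (fun i o => hθ _ (Nat.lt_succ_of_le (level_layerIdx _ _ _ _).le))
          fun o => ih o fun k hk => hθ k (Nat.lt_succ_of_lt hk)
      simp only [layerInput, hz]

lemma dependsOn_preact :
    DependsOn (fun θ : Params Di M Do L => preact φ θ x ℓ h) {k | level k ≤ ℓ} := fun _ _ hθ =>
  preact_congr (fun _ _ => hθ _ (level_layerIdx _ _ _ _).le)
    fun o => dependsOn_layerInput o fun k hk => hθ k (Nat.le_of_lt hk)

lemma continuous_preact_of_continuous_layerInput
    (hinput : ∀ o, Continuous (layerInput φ x ℓ h o : Params Di M Do L → ℝ)) (i : Fin M) :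
    Continuous fun θ : Params Di M Do L => preact φ θ x ℓ h i := by
  simp only [preact_eq_mulVec, Matrix.mulVec, dotProduct_fun_apply, coordMatrix, Matrix.of_apply]
  fun_prop

lemma continuous_layerInput (hφ : Continuous φ) (o : Option (Fin (fanIn Di M ℓ))) :
    Continuous (layerInput φ x ℓ h o : Params Di M Do L → ℝ) := by
  induction ℓ with
  | zero => cases o <;> exact continuous_const
  | succ ℓ ih =>
    cases o with
    | none => exact continuous_const
    | some j => exact (hφ.comp (continuous_preact_of_continuous_layerInput ih j)).div_const _

lemma continuous_preact (hφ : Continuous φ) (i : Fin M) :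
    Continuous fun θ : Params Di M Do L => preact φ θ x ℓ h i :=
  continuous_preact_of_continuous_layerInput (continuous_layerInput hφ) i

end LayerStructure

section Propagation

variable {Di M Do L : ℕ} {P : Measure (Params Di M Do L)} {φ : ℝ → ℝ} {K : ℝ}
  {x : EuclideanSpace ℝ (Fin Di)} {ℓ : ℕ} {h : ℓ ≤ L - 1}

lemma isRandomNeuron_layer (hP : IsIndepSymmetric P) (hφ : Continuous φ)
    (hinput : ∀ o, MemLp (layerInput φ x ℓ h o) 2 P) (i : Fin M) :
    IsRandomNeuron P (coordMatrix (layerIdx ℓ h) i) (layerInput φ x ℓ h) := by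
  refine hP.isRandomNeuron_coordMatrix (injective2_layerIdx ℓ h)
    (fun o => (continuous_layerInput hφ o).measurable) hinput (fun i o => ?_) i
  refine (dependsOn_layerInput o).mono ?_
  rintro _ hk ⟨p, rfl⟩
  exact hk.ne (level_layerIdx ℓ h i p)

lemma memLp_preact_of_memLp_layerInput (hP : IsIndepSymmetric P) (hφ : Continuous φ)
    (hinput : ∀ o, MemLp (layerInput φ x ℓ h o) 2 P) (i : Fin M) :
    MemLp (fun θ => preact φ θ x ℓ h i) 2 P := by
  simp only [preact_eq_mulVec]
  exact (isRandomNeuron_layer hP hφ hinput i).memLp_dotProduct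

lemma memLp_layerInput [IsFiniteMeasure P] {C : ℝ≥0} (hP : IsIndepSymmetric P)
    (hφ : LipschitzWith C φ) (o : Option (Fin (fanIn Di M ℓ))) :
    MemLp (layerInput φ x ℓ h o) 2 P := by
  induction ℓ with
  | zero => cases o <;> exact memLp_const _
  | succ ℓ ih =>
    cases o with
    | none => exact memLp_const _
    | some j =>
      have hpreact := memLp_preact_of_memLp_layerInput hP hφ.continuous
        (ih (h := Nat.le_of_succ_le h)) j
      exact (memLp_comp_of_lipschitzWith hφ hpreact).mul_const (√M)⁻¹

lemma memLp_preact [IsFiniteMeasure P] {C : ℝ≥0} (hP : IsIndepSymmetric P)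
    (hφ : LipschitzWith C φ) (i : Fin M) : MemLp (fun θ => preact φ θ x ℓ h i) 2 P :=
  memLp_preact_of_memLp_layerInput hP hφ.continuous (memLp_layerInput hP hφ) i

variable [IsProbabilityMeasure P]

lemma rms_preact_le (hP : IsIndepSymmetric P) (hK : 0 ≤ K)
    (hgap : ∑ k, standardizationGap P (fun θ => θ k) ≤ K ^ 2) {C : ℝ≥0}
    (hφ : LipschitzWith C φ) :
    rms P (fun i θ => preact φ θ x ℓ h i) ≤ (√M + K) * rms P (layerInput φ x ℓ h) := by
  simp only [preact_eq_mulVec]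
  simpa only [Fintype.card_fin] using rms_mulVec_le
    (isRandomNeuron_layer hP hφ.continuous (memLp_layerInput hP hφ)) hK
    ((sum_sum_standardizationGap_coordMatrix_le (injective2_layerIdx ℓ h)).trans hgap)

lemma rms_layerInput_zero_le {h : 0 ≤ L - 1} :
    rms P (layerInput φ x 0 h) ≤ 1 + ‖x‖ / √Di := by
  refine (rms_option_le _).trans_eq ?_
  have hx : rms P (fun (j : Fin Di) (_ : Params Di M Do L) => x j) = ‖x‖ := by
    simp [rms, EuclideanSpace.norm_eq]
  have hsome : rms P (fun (j : Fin Di) (_ : Params Di M Do L) => x j / √Di) = ‖x‖ / √Di := by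
    rw [rms_div_const, hx, abs_of_nonneg (Real.sqrt_nonneg _)]
  simp only [layerInput, one_pow, integral_const, probReal_univ, one_smul, Real.sqrt_one]
  exact congrArg (1 + ·) hsome

lemma rms_layerInput_succ_le (hM : 0 < M) (hP : IsIndepSymmetric P) (hK : 0 ≤ K)
    (hgap : ∑ k, standardizationGap P (fun θ => θ k) ≤ K ^ 2) {C : ℝ≥0}
    (hφ : LipschitzWith C φ) {h : ℓ + 1 ≤ L - 1} :
    rms P (layerInput φ x (ℓ + 1) h) ≤ 1 + |φ 0|
      + C * ((1 + K) * rms P (layerInput φ x ℓ (Nat.le_of_succ_le h))) := by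
  have hsqrt : 1 ≤ √(M : ℝ) := Real.one_le_sqrt.2 (by exact_mod_cast hM)
  have hnone : √(∫ θ, layerInput φ x (ℓ + 1) h none θ ^ 2 ∂P) = 1 := by simp [layerInput]
  have hpreact := rms_preact_le (x := x) (h := Nat.le_of_succ_le h) hP hK hgap hφ
  set R := rms P (layerInput φ x ℓ (Nat.le_of_succ_le h))
  have hR : 0 ≤ R := rms_nonneg _ _
  calc rms P (layerInput φ x (ℓ + 1) h)
      ≤ 1 + rms P (fun j θ => φ (preact φ θ x ℓ (Nat.le_of_succ_le h) j) / √M) :=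
        hnone ▸ rms_option_le _
    _ ≤ 1 + (√M * |φ 0| + C * ((√M + K) * R)) / √M := by
        rw [rms_div_const, abs_of_nonneg (Real.sqrt_nonneg _)]
        gcongr
        refine (rms_comp_le_of_lipschitzWith hφ fun j => memLp_preact hP hφ j).trans ?_
        rw [Fintype.card_fin]
        gcongr
    _ = 1 + |φ 0| + C * ((1 + K / √M) * R) := by
        field_simp
        ring
    _ ≤ 1 + |φ 0| + C * ((1 + K) * R) := by
        gcongr
        exact div_le_self hK hsqrt

lemma rms_layerInput_le (hM : 0 < M) (hP : IsIndepSymmetric P) (hK : 0 ≤ K)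
    (hgap : ∑ k, standardizationGap P (fun θ => θ k) ≤ K ^ 2) (hφ : LipschitzWith 1 φ) :
    rms P (layerInput φ x ℓ h) ≤ (ℓ + 1) * (1 + K) ^ ℓ * (|φ 0| + 1 + ‖x‖ / √Di) := by
  set S := |φ 0| + 1 + ‖x‖ / √Di
  have hx : 0 ≤ ‖x‖ / √Di := by positivity
  induction ℓ with
  | zero =>
    refine rms_layerInput_zero_le.trans ?_
    rw [Nat.cast_zero, zero_add, pow_zero, one_mul, one_mul]
    linarith [abs_nonneg (φ 0)]
  | succ ℓ ih =>
    have hpow : (1 : ℝ) ≤ (1 + K) ^ (ℓ + 1) := one_le_pow₀ (by linarith)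
    calc rms P (layerInput φ x (ℓ + 1) h)
        ≤ 1 + |φ 0| + (1 + K) * rms P (layerInput φ x ℓ (Nat.le_of_succ_le h)) := by
          simpa only [NNReal.coe_one, one_mul] using rms_layerInput_succ_le hM hP hK hgap hφ
      _ ≤ 1 * S + (1 + K) * ((ℓ + 1) * (1 + K) ^ ℓ * S) := by
          gcongr
          · linarith
          · exact ih
      _ ≤ (1 + K) ^ (ℓ + 1) * S + (1 + K) * ((ℓ + 1) * (1 + K) ^ ℓ * S) := by gcongr
      _ = ((ℓ + 1 : ℕ) + 1) * (1 + K) ^ (ℓ + 1) * S := by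
          push_cast
          ring

lemma sum_sq_integral_comp_preact_le_of_odd (hP : IsIndepSymmetric P)
    (hgap : ∑ k, standardizationGap P (fun θ => θ k) ≤ K ^ 2) {C D : ℝ≥0}
    (hφ : LipschitzWith C φ) {ψ : ℝ → ℝ} (hψ : LipschitzWith D ψ) (hodd : ψ.Odd) :
    ∑ i, (∫ θ, ψ (preact φ θ x ℓ h i) ∂P) ^ 2
      ≤ (D * (K * rms P (layerInput φ x ℓ h))) ^ 2 := by
  simp only [preact_eq_mulVec]
  exact sum_sq_integral_comp_mulVec_le_of_odd
    (isRandomNeuron_layer hP hφ.continuous (memLp_layerInput hP hφ))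
    ((sum_sum_standardizationGap_coordMatrix_le (injective2_layerIdx ℓ h)).trans hgap)
    (fun _ _ => hP.isMeanSymmetric_eval _) hψ hodd

end Propagation

section Output

variable {Di M Do L : ℕ} {P : Measure (Params Di M Do L)} {φ : ℝ → ℝ} {α K : ℝ}
  {x : EuclideanSpace ℝ (Fin Di)}

lemma evenPart_zero (φ : ℝ → ℝ) : evenPart φ 0 = φ 0 := by
  rw [evenPart, neg_zero, add_self_div_two]

lemma odd_sub_const_of_evenPart_eq (hα : ∀ a, evenPart φ a = α) :
    Function.Odd fun a => φ a - α := fun a => by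
  linarith [show (φ a + φ (-a)) / 2 = α from hα a]

/-- The input of the output layer with the even part `α` of the activation removed, before the
scaling by `1 / √M`. -/
noncomputable def oddOutputInput (φ : ℝ → ℝ) (α : ℝ) (x : EuclideanSpace ℝ (Fin Di)) (j : Fin M)
    (θ : Params Di M Do L) : ℝ :=
  φ (preact φ θ x (L - 1) le_rfl j) - α

lemma networkTilde_apply (θ : Params Di M Do L) (i : Fin Do) :
    networkTilde φ α θ x i
      = (coordMatrix .outputWeight *ᵥ oddOutputInput φ α x) i θ / √M := by
  rw [Matrix.mulVec, dotProduct_fun_apply]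
  simp only [networkTilde, network, PiLp.sub_apply, Pi.add_apply, Pi.smul_apply, smul_eq_mul,
    Matrix.mulVec, dotProduct, Params.outputWeight, coordMatrix, Matrix.of_apply, oddOutputInput,
    mul_sub, Finset.sum_sub_distrib, mul_one, ← Finset.sum_mul]
  ring

/-- The part `(α / √M) W_{L+1} 1 + b_{L+1}` of the network output, which does not depend on the
network input. -/
noncomputable def inputFreeOutput (α : ℝ) (θ : Params Di M Do L) : EuclideanSpace ℝ (Fin Do) :=
  WithLp.toLp 2 ((α / √(M : ℝ)) • θ.outputWeight.mulVec (fun _ => (1 : ℝ)) + θ.outputBias)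

lemma network_eq_networkTilde_add (φ : ℝ → ℝ) (α : ℝ) (θ : Params Di M Do L)
    (x : EuclideanSpace ℝ (Fin Di)) :
    network φ θ x = networkTilde φ α θ x + inputFreeOutput α θ := by
  rw [networkTilde, inputFreeOutput, WithLp.toLp_add]
  abel

lemma integrable_inputFreeOutput (hP : ∀ k, Integrable (fun θ : Params Di M Do L => θ k) P)
    (α : ℝ) : Integrable (inputFreeOutput α) P := by
  refine .of_eval_piLp fun i => ?_
  simp only [inputFreeOutput, Pi.add_apply, Pi.smul_apply, smul_eq_mul, Matrix.mulVec, dotProduct,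
    Params.outputWeight, Params.outputBias, Matrix.of_apply, mul_one]
  exact ((integrable_finsetSum _ fun j _ => hP _).const_mul _).add (hP _)

variable [IsProbabilityMeasure P]

lemma isRandomNeuron_output {C : ℝ≥0} (hP : IsIndepSymmetric P) (hφ : LipschitzWith C φ)
    (i : Fin Do) :
    IsRandomNeuron P (coordMatrix .outputWeight i) (oddOutputInput φ α x) := by
  refine hP.isRandomNeuron_coordMatrix injective2_outputWeight
    (fun j => ((hφ.continuous.comp (continuous_preact hφ.continuous j)).sub
      continuous_const).measurable)
    (fun j => (memLp_comp_of_lipschitzWith hφ (memLp_preact hP hφ j)).sub (memLp_const α))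
    (fun i j θ θ' hθ => ?_) i
  have hpreact : preact φ θ x (L - 1) le_rfl = preact φ θ' x (L - 1) le_rfl :=
    dependsOn_preact fun k hk => hθ k <| by
      rintro ⟨p, rfl⟩
      exact (Nat.lt_succ_self (L - 1)).not_ge hk
  exact congrArg (fun z => φ (z j) - α) hpreact

lemma integrable_networkTilde {C : ℝ≥0} (hP : IsIndepSymmetric P) (hφ : LipschitzWith C φ) :
    Integrable (fun θ => networkTilde φ α θ x) P := by
  have happly : ∀ i, Integrable (fun θ => networkTilde φ α θ x i) P := fun i => by
    simp only [networkTilde_apply]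
    exact ((isRandomNeuron_output hP hφ i).memLp_dotProduct.integrable one_le_two).div_const _
  exact .of_eval_piLp happly

lemma sum_sq_integral_oddOutputInput_le (hM : 0 < M) (hP : IsIndepSymmetric P) (hK : 0 ≤ K)
    (hgap : ∑ k, standardizationGap P (fun θ => θ k) ≤ K ^ 2) (hφ : LipschitzWith 1 φ)
    (hα : ∀ a, evenPart φ a = α) :
    ∑ j, P[oddOutputInput φ α x j] ^ 2
      ≤ (K * (((L - 1 : ℕ) + 1) * (1 + K) ^ (L - 1) * (|α| + 1 + ‖x‖ / √Di))) ^ 2 := by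
  have hα₀ : φ 0 = α := (evenPart_zero φ).symm.trans (hα 0)
  have hrms := rms_layerInput_le (x := x) (h := le_rfl) hM hP hK hgap hφ
  rw [hα₀] at hrms
  refine (sum_sq_integral_comp_preact_le_of_odd hP hgap hφ (lipschitzWith_sub_const hφ α)
    (odd_sub_const_of_evenPart_eq hα)).trans ?_
  rw [NNReal.coe_one, one_mul]
  exact pow_le_pow_left₀ (mul_nonneg hK (rms_nonneg _ _)) (mul_le_mul_of_nonneg_left hrms hK) 2

lemma norm_integral_networkTilde_le (hM : 0 < M) (hP : IsIndepSymmetric P) (hK : 0 ≤ K)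
    (hgap : ∑ k, standardizationGap P (fun θ => θ k) ≤ K ^ 2) (hφ : LipschitzWith 1 φ)
    (hα : ∀ a, evenPart φ a = α) :
    ‖∫ θ, networkTilde φ α θ x ∂P‖
      ≤ K ^ 2 * (((L - 1 : ℕ) + 1) * (1 + K) ^ (L - 1) * (|α| + 1 + ‖x‖ / √Di)) / √M := by
  have happly : ∀ i, (∫ θ, networkTilde φ α θ x ∂P) i
      = (∫ θ, (coordMatrix .outputWeight *ᵥ oddOutputInput φ α x) i θ ∂P) / √M := fun i => by
    rw [eval_integral_piLp fun i => (integrable_networkTilde hP hφ).eval_piLp i,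
      ← integral_div]
    simp only [networkTilde_apply]
  have hweight := (sum_sum_standardizationGap_coordMatrix_le injective2_outputWeight).trans hgap
  have houtput := sum_sq_integral_mulVec_le
    (isRandomNeuron_output (α := α) (x := x) hP hφ) hweight
  have hinput := sum_sq_integral_oddOutputInput_le (x := x) hM hP hK hgap hφ hα
  set B := ((L - 1 : ℕ) + 1) * (1 + K) ^ (L - 1) * (|α| + 1 + ‖x‖ / √Di)
  refine le_of_sq_le_sq ?_ (by positivity)
  calc ‖∫ θ, networkTilde φ α θ x ∂P‖ ^ 2
      = (∑ i, (∫ θ, (coordMatrix .outputWeight *ᵥ oddOutputInput φ α x) i θ ∂P) ^ 2)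
          / √M ^ 2 := by
        simp only [EuclideanSpace.real_norm_sq_eq, happly, div_pow, ← Finset.sum_div]
    _ ≤ K ^ 2 * (K * B) ^ 2 / √M ^ 2 := by
        gcongr
        exact houtput.trans (by gcongr)
    _ = (K ^ 2 * B / √M) ^ 2 := by ring

end Output

section MeanFieldGaussian

variable {Di M Do L : ℕ} {m : ParamIdx Di M Do L → ℝ} {v : ParamIdx Di M Do L → ℝ≥0}

instance isProbabilityMeasure_diagGaussian : IsProbabilityMeasure (diagGaussian m v) := by
  unfold diagGaussian
  infer_instance

lemma isIndepSymmetric_diagGaussian : IsIndepSymmetric (diagGaussian m v) :=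
  isIndepSymmetric_pi_gaussianReal m v

lemma klDiv_diagGaussian_prior_ne_top (m : ParamIdx Di M Do L → ℝ) (hv : ∀ i, 0 < v i) :
    klDiv (diagGaussian m v) (prior Di M Do L) ≠ ∞ :=
  klDiv_pi_ne_top fun i => klDiv_gaussianReal_ne_top _ _ (hv i).ne' one_ne_zero

lemma sum_standardizationGap_diagGaussian_le (hv : ∀ i, 0 < v i) :
    ∑ k, standardizationGap (diagGaussian m v) (fun θ => θ k)
      ≤ 2 * klPrior (diagGaussian m v) := by
  have hkl : klPrior (diagGaussian m v)
      = ∑ k, (klDiv (gaussianReal (m k) (v k)) (gaussianReal 0 1)).toReal :=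
    toReal_klDiv_pi fun i => klDiv_gaussianReal_ne_top _ _ (hv i).ne' one_ne_zero
  rw [hkl, Finset.mul_sum]
  refine Finset.sum_le_sum fun k _ => ?_
  exact (standardizationGap_eval_pi_gaussianReal k).trans_le
    (sq_add_sqrt_sub_one_sq_le_klDiv_gaussianReal _ (hv k).ne')

lemma one_add_sqrt_pow_le {t : ℝ} (ht : 0 ≤ t) (n : ℕ) :
    (1 + √t) ^ n ≤ 2 ^ n * max (t ^ ((n : ℝ) / 2)) 1 := by
  have hpow : t ^ ((n : ℝ) / 2) = √t ^ n := by
    rw [Real.sqrt_eq_rpow, ← Real.rpow_natCast, ← Real.rpow_mul ht, one_div_mul_eq_div]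
  rw [hpow]
  rcases le_total (√t) 1 with h | h
  · calc (1 + √t) ^ n ≤ 2 ^ n := pow_le_pow_left₀ (by positivity) (by linarith) n
      _ ≤ _ := le_mul_of_one_le_right (by positivity) (le_max_right _ _)
  · calc (1 + √t) ^ n ≤ (2 * √t) ^ n := pow_le_pow_left₀ (by positivity) (by linarith) n
      _ = 2 ^ n * √t ^ n := mul_pow _ _ _
      _ ≤ _ := by gcongr; exact le_max_left _ _

lemma norm_integral_networkTilde_diagGaussian_le {φ : ℝ → ℝ} {α : ℝ} (hM : 0 < M) (hL : 1 ≤ L)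
    (hφ : LipschitzWith 1 φ) (hα : ∀ a, evenPart φ a = α) (hv : ∀ i, 0 < v i)
    (x : EuclideanSpace ℝ (Fin Di)) :
    ‖∫ θ, networkTilde φ α θ x ∂diagGaussian m v‖
      ≤ 2 * 2 ^ (L - 1) * L * ((|α| + 1 + ‖x‖ / √Di) / √M) * klPrior (diagGaussian m v)
        * max ((2 * klPrior (diagGaussian m v)) ^ (((L : ℝ) - 1) / 2)) 1 := by
  have hgap := sum_standardizationGap_diagGaussian_le (m := m) hv
  have hkl : 0 ≤ klPrior (diagGaussian m v) := ENNReal.toReal_nonneg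
  set t := klPrior (diagGaussian m v)
  have hsq : √(2 * t) ^ 2 = 2 * t := Real.sq_sqrt (by positivity)
  have hbound := norm_integral_networkTilde_le (x := x) hM isIndepSymmetric_diagGaussian
    (Real.sqrt_nonneg _) (hgap.trans_eq hsq.symm) hφ hα
  have hpow := one_add_sqrt_pow_le (by positivity : 0 ≤ 2 * t) (L - 1)
  rw [Nat.cast_pred hL] at hbound hpow
  rw [hsq, sub_add_cancel] at hbound
  calc ‖∫ θ, networkTilde φ α θ x ∂diagGaussian m v‖
      ≤ 2 * t * (L * (1 + √(2 * t)) ^ (L - 1) * (|α| + 1 + ‖x‖ / √Di)) / √M := hbound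
    _ ≤ 2 * t * (L * (2 ^ (L - 1) * max ((2 * t) ^ (((L : ℝ) - 1) / 2)) 1)
          * (|α| + 1 + ‖x‖ / √Di)) / √M := by gcongr
    _ = _ := by ring

end MeanFieldGaussian

end MeanFieldBNN

theorem mainTheorem2 :
    ∃ c₁ c₂ : ℝ, 0 < c₁ ∧ c₁ ≤ 4 ∧ 0 < c₂ ∧ c₂ ≤ 6 ∧
      ∀ (Di M Do L : ℕ), 0 < Di → 0 < M → 1 ≤ L →
      ∀ (φ : ℝ → ℝ) (α : ℝ), LipschitzWith 1 φ → (∀ a, MeanFieldBNN.evenPart φ a = α) →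
      ∀ Q : MeasureTheory.Measure (MeanFieldBNN.Params Di M Do L),
        MeanFieldBNN.IsMeanFieldGaussian Q →
        InformationTheory.klDiv Q (MeanFieldBNN.prior Di M Do L) ≠ ⊤ ∧
        (∀ x : EuclideanSpace ℝ (Fin Di),
          MeasureTheory.Integrable (fun θ => MeanFieldBNN.networkTilde φ α θ x) Q ∧
          ‖∫ θ, MeanFieldBNN.networkTilde φ α θ x ∂Q‖
            ≤ c₁ * c₂ ^ (L - 1) * (L : ℝ)
              * ((|α| + 1 + ‖x‖ / √(Di : ℝ)) / √(M : ℝ))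
              * MeanFieldBNN.klPrior Q
              * max ((2 * MeanFieldBNN.klPrior Q) ^ (((L : ℝ) - 1) / 2)) 1) ∧
        (∀ x x' : EuclideanSpace ℝ (Fin Di),
          MeasureTheory.Integrable (fun θ => MeanFieldBNN.network φ θ x) Q ∧
          MeasureTheory.Integrable (fun θ => MeanFieldBNN.network φ θ x') Q ∧
          ‖(∫ θ, MeanFieldBNN.network φ θ x ∂Q) - ∫ θ, MeanFieldBNN.network φ θ x' ∂Q‖
            ≤ c₁ * c₂ ^ (L - 1) * (L : ℝ)
              * ((2 * |α| + 2 + (‖x‖ + ‖x'‖) / √(Di : ℝ)) / √(M : ℝ))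
              * MeanFieldBNN.klPrior Q
              * max ((2 * MeanFieldBNN.klPrior Q) ^ (((L : ℝ) - 1) / 2)) 1) := by
  refine ⟨2, 2, by norm_num, by norm_num, by norm_num, by norm_num, ?_⟩
  rintro Di M Do L - hM hL φ α hφ hα Q ⟨m, v, hv, rfl⟩
  have hP := MeanFieldBNN.isIndepSymmetric_diagGaussian (m := m) (v := v)
  have htilde := fun x => MeanFieldBNN.integrable_networkTilde (α := α) (x := x) hP hφ
  have hbound := MeanFieldBNN.norm_integral_networkTilde_diagGaussian_le (m := m) hM hL hφ hα hv
  have hfree := MeanFieldBNN.integrable_inputFreeOutput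
    (fun k => (hP.memLp_eval k).integrable one_le_two) α
  have hnet : ∀ x, Integrable (fun θ => MeanFieldBNN.network φ θ x)
      (MeanFieldBNN.diagGaussian m v) := fun x => by
    simp only [MeanFieldBNN.network_eq_networkTilde_add φ α]
    exact (htilde x).add hfree
  refine ⟨MeanFieldBNN.klDiv_diagGaussian_prior_ne_top m hv, fun x => ⟨htilde x, hbound x⟩,
    fun x x' => ⟨hnet x, hnet x', ?_⟩⟩
  simp only [MeanFieldBNN.network_eq_networkTilde_add φ α]
  rw [integral_add (htilde x) hfree, integral_add (htilde x') hfree, add_sub_add_right_eq_sub]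
  refine (norm_sub_le _ _).trans ((add_le_add (hbound x) (hbound x')).trans_eq ?_)
  ring
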